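/- Let $T>0$, $h>0$ and $c>0$ be fixed. For $m>0$ and $g>0$ put $K(\lambda,\mu)=\dfrac{4mg}{(\lambda-\mu)^2+(2mg)^2}$ and consider the Yang–Yang equation $$\varepsilon(\lambda)=\frac{\lambda^2}{2m}-h-\frac{T}{2\pi}\int_{-\infty}^{\infty}K(\lambda,\mu)\ln\left(1+e^{-\varepsilon(\mu)/T}\right)d\mu ,\qquad \lambda\in\mathbb R,$$ where a solution is a function $\varepsilon:\mathbb R\to\mathbb R$ for which the integrand is Lebesgue integrable for every $\lambda$ and the equation holds for every $\lambda$. In the small mass limit $m\to 0$, $g\to\infty$ with $2mg=c$ fixed, the solution satisfies $\varepsilon(\lambda)=\frac{\lambda^2}{2m}-h+O(\sqrt m)$, uniformly in $\lambda$. That is, there are constants $C>0$ and $m_0>0$, depending only on $T,h,c$, such that for all $m\in(0,m_0)$ and $g>0$ with $2mg=c$ the equation has a solution, and every solution $\varepsilon$ satisfies $$\left|\varepsilon(\lambda)-\left(\frac{\lambda^2}{2m}-h\right)\right|\le C\sqrt m\qquad\text{for all }\lambda\in\mathbb R .$$ -/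

import Mathlib

open MeasureTheory

/-- The Yang-Yang kernel `K(x, y) = 4 m g / ((x - y)² + (2 m g)²)`. -/
noncomputable def yangYangKernel (m g x y : ℝ) : ℝ :=
  4 * m * g / ((x - y) ^ 2 + (2 * m * g) ^ 2)

/-- `ε` solves the Yang-Yang equation with mass `m`, coupling constant `g`, temperature `T` and
chemical potential `h`: for every real `x` the integrand is Lebesgue integrable on `ℝ`, and
`ε(x) = x² / (2 m) - h - T / (2 π) ∫ K(x, y) ln (1 + exp (- ε(y) / T)) dy`. -/
structure IsYangYangSolution (m g T h : ℝ) (ε : ℝ → ℝ) : Prop where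
  integrable : ∀ x : ℝ, Integrable
    (fun y : ℝ => yangYangKernel m g x y * Real.log (1 + Real.exp (-(ε y / T)))) volume
  equation : ∀ x : ℝ, ε x = x ^ 2 / (2 * m) - h -
    T / (2 * Real.pi) *
      ∫ y : ℝ, yangYangKernel m g x y * Real.log (1 + Real.exp (-(ε y / T)))

/-!
Divided by `2 π`, the kernel `K(x, ·)` is the density of the Cauchy distribution of scale
`c = 2 m g` centred at `x`, so `D = x² / (2 m) - h - ε` is the Cauchy average of the softplus of
`D + h - y² / (2 m)`. Let `M` bound `D` from above.

* Each of these Cauchy distributions gives mass at least `1 / 2` to `|y| ≥ c / 2`, where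
  `y² / (2 m)` is large when `m` is small. Since the softplus at temperature `T` exceeds the
  positive part by at most `T ln 2`, averaging improves `M` to
  `M + h + T ln 2 - min (M + h) (c² / (8 m)) / 2`. For small `m` this forces
  `M ≤ h + 2 T ln 2` when `M = sup D`, and it makes the constant `h + 2 T ln 2` a supersolution
  from which monotone iteration produces a solution.
* The Cauchy density is at most `1 / (π c)` and the softplus at most `T exp (· / T)`, so a bound on
  `D` that is uniform in `m` leaves a Gaussian integral of order `√m`.
* That `sup D` is finite for every solution is the delicate point: Cauchy averages of an integrable
  function grow more slowly than any multiple of `x²`, so the argument of the softplus is bounded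
  above.
-/

open Filter ProbabilityTheory Set
open scoped NNReal Real Topology

theorem tendsto_integral_max_sub_zero {α : Type*} [MeasurableSpace α] {μ : Measure α}
    {f : α → ℝ} (hf : Integrable f μ) :
    Tendsto (fun t : ℝ => ∫ y, max (f y - t) 0 ∂μ) atTop (𝓝 0) := by
  suffices Tendsto (fun t : ℝ => ∫ y, max (f y - t) 0 ∂μ) atTop (𝓝 (∫ _, (0 : ℝ) ∂μ)) by
    simpa only [integral_zero] using this
  refine tendsto_integral_filter_of_dominated_convergence (fun y => |f y|)
    (Eventually.of_forall fun t =>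
      (hf.aestronglyMeasurable.sub aestronglyMeasurable_const).sup aestronglyMeasurable_const)
    ?_ hf.abs (ae_of_all _ fun y => ?_)
  · filter_upwards [eventually_ge_atTop 0] with t ht
    refine ae_of_all _ fun y => ?_
    rw [Real.norm_of_nonneg (le_max_right _ _)]
    exact max_le (by linarith [le_abs_self (f y)]) (abs_nonneg _)
  · refine tendsto_const_nhds.congr' ?_
    filter_upwards [eventually_ge_atTop (f y)] with t ht
    exact (max_eq_right (by linarith)).symm

/-- The Hammerstein operator `u ↦ ∫ φ(y, u(y)) κ(·, dy)` of a transition kernel `κ` and a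
nonlinearity `φ`. The interaction term of the Yang-Yang equation is of this form. -/
noncomputable def hammerstein {α β : Type*} [MeasurableSpace α] [MeasurableSpace β]
    (κ : Kernel α β) (φ : β → ℝ → ℝ) (u : β → ℝ) (x : α) : ℝ :=
  ∫ y, φ y (u y) ∂κ x

section Hammerstein

variable {α β : Type*} [MeasurableSpace α] [MeasurableSpace β] {φ : β → ℝ → ℝ}

theorem measurable_hammerstein (κ : Kernel α β) (hφ : Measurable (Function.uncurry φ))
    {u : β → ℝ} (hu : Measurable u) : Measurable (hammerstein κ φ u) :=
  (hφ.comp (measurable_id.prodMk hu)).stronglyMeasurable.integral_kernel.measurable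

theorem integrable_comp_of_mem_Icc {μ : Measure β} (hφ : Measurable (Function.uncurry φ))
    (hmono : ∀ y, Monotone (φ y)) {a b u : β → ℝ} (ha : Integrable (fun y => φ y (a y)) μ)
    (hb : Integrable (fun y => φ y (b y)) μ) (hu : Measurable u) (hab : u ∈ Icc a b) :
    Integrable (fun y => φ y (u y)) μ :=
  integrable_of_le_of_le (hφ.comp (measurable_id.prodMk hu)).aestronglyMeasurable
    (ae_of_all _ fun y => hmono y (hab.1 y)) (ae_of_all _ fun y => hmono y (hab.2 y)) ha hb

theorem hammerstein_le_hammerstein {κ : Kernel α β} (hmono : ∀ y, Monotone (φ y)) {u v : β → ℝ}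
    (hu : ∀ x, Integrable (fun y => φ y (u y)) (κ x))
    (hv : ∀ x, Integrable (fun y => φ y (v y)) (κ x)) (huv : u ≤ v) :
    hammerstein κ φ u ≤ hammerstein κ φ v := fun x =>
  integral_mono (hu x) (hv x) fun y => hmono y (huv y)

theorem tendsto_hammerstein_of_monotone {κ : Kernel α β} (hmono : ∀ y, Monotone (φ y))
    (hcont : ∀ y, Continuous (φ y)) {u : ℕ → β → ℝ} {v : β → ℝ} {x : α}
    (hu : ∀ n, Integrable (fun y => φ y (u n y)) (κ x))
    (hv : Integrable (fun y => φ y (v y)) (κ x)) (hu_mono : Monotone u)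
    (hlim : ∀ y, Tendsto (fun n => u n y) atTop (𝓝 (v y))) :
    Tendsto (fun n => hammerstein κ φ (u n) x) atTop (𝓝 (hammerstein κ φ v x)) :=
  integral_tendsto_of_tendsto_of_monotone hu hv
    (ae_of_all _ fun y => (hmono y).comp fun _ _ hnk => hu_mono hnk y)
    (ae_of_all _ fun y => ((hcont y).tendsto _).comp (hlim y))

theorem exists_eq_hammerstein_of_le_of_ge {κ : Kernel α α} {φ : α → ℝ → ℝ} {a b : α → ℝ}
    (hφ : Measurable (Function.uncurry φ)) (hmono : ∀ y, Monotone (φ y))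
    (hcont : ∀ y, Continuous (φ y)) (ham : Measurable a) (hab : a ≤ b)
    (ha : ∀ x, Integrable (fun y => φ y (a y)) (κ x))
    (hb : ∀ x, Integrable (fun y => φ y (b y)) (κ x))
    (hsub : a ≤ hammerstein κ φ a) (hsuper : hammerstein κ φ b ≤ b) :
    ∃ u : α → ℝ, Measurable u ∧ u ∈ Icc a b ∧ u = hammerstein κ φ u := by
  set u : ℕ → α → ℝ := fun n => (hammerstein κ φ)^[n] a
  have hsucc (n : ℕ) : u (n + 1) = hammerstein κ φ (u n) := Function.iterate_succ_apply' _ _ _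
  have hint {v : α → ℝ} (hv : Measurable v) (hvab : v ∈ Icc a b) (x : α) :
      Integrable (fun y => φ y (v y)) (κ x) :=
    integrable_comp_of_mem_Icc hφ hmono (ha x) (hb x) hv hvab
  have hiter (n : ℕ) : Measurable (u n) ∧ u n ∈ Icc a b ∧ u n ≤ u (n + 1) := by
    induction n with
    | zero => exact ⟨ham, ⟨le_rfl, hab⟩, hsub⟩
    | succ n ih =>
      obtain ⟨hmeas, hmem, hstep⟩ := ih
      have hmeas' : Measurable (u (n + 1)) := hsucc n ▸ measurable_hammerstein κ hφ hmeas
      have hmem' : u (n + 1) ∈ Icc a b := ⟨hmem.1.trans hstep, hsucc n ▸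
        (hammerstein_le_hammerstein hmono (hint hmeas hmem) hb hmem.2).trans hsuper⟩
      refine ⟨hmeas', hmem', ?_⟩
      rw [hsucc (n + 1)]
      exact (hsucc n).trans_le (hammerstein_le_hammerstein hmono (hint hmeas hmem)
        (hint hmeas' hmem') hstep)
  have hu_mono : Monotone u := monotone_nat_of_le_succ fun n => (hiter n).2.2
  have hlim (x : α) : Tendsto (fun n => u n x) atTop (𝓝 (⨆ n, u n x)) :=
    tendsto_atTop_ciSup (fun _ _ hnk => hu_mono hnk x)
      ⟨b x, forall_mem_range.2 fun n => (hiter n).2.1.2 x⟩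
  have hmeas : Measurable fun x => ⨆ n, u n x := .iSup fun n => (hiter n).1
  have hmem : (fun x => ⨆ n, u n x) ∈ Icc a b :=
    ⟨fun x => ge_of_tendsto' (hlim x) fun n => (hiter n).2.1.1 x,
      fun x => le_of_tendsto' (hlim x) fun n => (hiter n).2.1.2 x⟩
  refine ⟨_, hmeas, hmem, funext fun x =>
    tendsto_nhds_unique ((hlim x).comp (tendsto_add_atTop_nat 1)) ?_⟩
  simp only [Function.comp_def, hsucc]
  exact tendsto_hammerstein_of_monotone hmono hcont
    (fun n => hint (hiter n).1 (hiter n).2.1 x) (hint hmeas hmem x) hu_mono hlim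

end Hammerstein

/-- The softplus function at temperature `T`: a smoothing of `max z 0` whose value at `-ε` is the
thermal contribution `T ln (1 + exp (-ε / T))` of a mode of energy `ε`. -/
noncomputable def softplus (T z : ℝ) : ℝ :=
  T * Real.log (1 + Real.exp (z / T))

section Softplus

variable {T : ℝ}

theorem softplus_nonneg (hT : 0 ≤ T) (z : ℝ) : 0 ≤ softplus T z :=
  mul_nonneg hT (Real.log_nonneg (by linarith [Real.exp_pos (z / T)]))

theorem monotone_softplus (hT : 0 ≤ T) : Monotone (softplus T) := by
  intro z w hzw
  unfold softplus
  gcongr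

theorem continuous_softplus (T : ℝ) : Continuous (softplus T) := by
  unfold softplus
  exact continuous_const.mul (Continuous.log (by fun_prop) fun z => by positivity)

theorem softplus_le_mul_exp (hT : 0 ≤ T) (z : ℝ) : softplus T z ≤ T * Real.exp (z / T) := by
  refine mul_le_mul_of_nonneg_left ?_ hT
  linarith [Real.log_le_sub_one_of_pos (show 0 < 1 + Real.exp (z / T) by positivity)]

theorem softplus_le_max_add (hT : 0 < T) (z : ℝ) : softplus T z ≤ max z 0 + T * Real.log 2 := by
  have hexp : 1 + Real.exp (z / T) ≤ 2 * Real.exp (max z 0 / T) := by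
    have hone : 1 ≤ Real.exp (max z 0 / T) := Real.one_le_exp (by positivity)
    have hmax : Real.exp (z / T) ≤ Real.exp (max z 0 / T) := by
      gcongr
      exact le_max_left z 0
    linarith
  calc softplus T z ≤ T * Real.log (2 * Real.exp (max z 0 / T)) := by
        unfold softplus
        gcongr
    _ = max z 0 + T * Real.log 2 := by
        rw [Real.log_mul two_ne_zero (Real.exp_ne_zero _), Real.log_exp]
        field_simp
        ring

theorem integrable_softplus_of_le {α : Type*} [MeasurableSpace α] {μ : Measure α}
    [IsFiniteMeasure μ] {f : α → ℝ} {M : ℝ} (hT : 0 ≤ T) (hf : Measurable f) (hM : ∀ y, f y ≤ M) :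
    Integrable (fun y => softplus T (f y)) μ := by
  refine .of_bound ((continuous_softplus T).measurable.comp hf).aestronglyMeasurable
    (softplus T M) (ae_of_all _ fun y => ?_)
  rw [Real.norm_of_nonneg (softplus_nonneg hT _)]
  exact monotone_softplus hT (hM y)

theorem integral_softplus_sub_le {α : Type*} [MeasurableSpace α] {μ : Measure α}
    [IsProbabilityMeasure μ] {V : α → ℝ} {E v : ℝ} {s : Set α} (hT : 0 < T) (hE : 0 ≤ E)
    (hV : Measurable V) (hV0 : ∀ y, 0 ≤ V y) (hs : MeasurableSet s) (hvs : ∀ y ∈ s, v ≤ V y) :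
    ∫ y, softplus T (E - V y) ∂μ ≤ E + T * Real.log 2 - min E v * μ.real s := by
  have hind : Integrable (s.indicator fun _ => min E v) μ := (integrable_const _).indicator hs
  have hpt (y : α) :
      softplus T (E - V y) ≤ E + T * Real.log 2 - s.indicator (fun _ => min E v) y := by
    refine (softplus_le_max_add hT _).trans ?_
    suffices max (E - V y) 0 ≤ E - s.indicator (fun _ => min E v) y by linarith
    by_cases hy : y ∈ s
    · rw [indicator_of_mem hy]
      exact max_le (by linarith [min_le_right E v, hvs y hy]) (by linarith [min_le_left E v])
    · rw [indicator_of_notMem hy]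
      exact max_le (by linarith [hV0 y]) (by linarith)
  calc ∫ y, softplus T (E - V y) ∂μ
      ≤ ∫ y, (E + T * Real.log 2 - s.indicator (fun _ => min E v) y) ∂μ :=
        integral_mono
          (integrable_softplus_of_le hT.le (hV.const_sub E) fun y => sub_le_self E (hV0 y))
          ((integrable_const _).sub hind) hpt
    _ = E + T * Real.log 2 - min E v * μ.real s := by
        rw [integral_sub (integrable_const _) hind, integral_indicator_const _ hs]
        simp [mul_comm]

theorem softplus_sub_mul_sq_le (hT : 0 ≤ T) (E a y : ℝ) :
    softplus T (E - a * y ^ 2) ≤ T * Real.exp (E / T) * Real.exp (-(a / T) * y ^ 2) := by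
  refine (softplus_le_mul_exp hT _).trans_eq ?_
  rw [mul_assoc, ← Real.exp_add]
  ring_nf

theorem integrable_softplus_sub_mul_sq {a : ℝ} (hT : 0 < T) (ha : 0 < a) (E : ℝ) :
    Integrable fun y : ℝ => softplus T (E - a * y ^ 2) := by
  refine ((integrable_exp_neg_mul_sq (div_pos ha hT)).const_mul (T * Real.exp (E / T))).mono'
    ((continuous_softplus T).comp (by fun_prop)).aestronglyMeasurable (ae_of_all _ fun y => ?_)
  rw [Real.norm_of_nonneg (softplus_nonneg hT.le _)]
  exact softplus_sub_mul_sq_le hT.le E a y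

theorem integral_softplus_sub_mul_sq_le {a : ℝ} (hT : 0 < T) (ha : 0 < a) (E : ℝ) :
    ∫ y : ℝ, softplus T (E - a * y ^ 2) ≤ T * Real.exp (E / T) * √(π * T / a) := by
  calc ∫ y : ℝ, softplus T (E - a * y ^ 2)
      ≤ ∫ y : ℝ, T * Real.exp (E / T) * Real.exp (-(a / T) * y ^ 2) :=
        integral_mono (integrable_softplus_sub_mul_sq hT ha E)
          ((integrable_exp_neg_mul_sq (div_pos ha hT)).const_mul _)
          (softplus_sub_mul_sq_le hT.le E a)
    _ = T * Real.exp (E / T) * √(π * T / a) := by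
        rw [integral_const_mul, integral_gaussian, div_div_eq_mul_div]

end Softplus

section Cauchy

variable {γ : ℝ≥0}

theorem cauchyPDFReal_le (x y : ℝ) : cauchyPDFReal x γ y ≤ (π * γ)⁻¹ := by
  rw [cauchyPDFReal_def', NNReal.coe_inv, ← mul_inv]
  refine mul_le_of_le_one_right (by positivity) (inv_le_one_of_one_le₀ ?_)
  linarith [sq_nonneg ((y - x) / γ)]

theorem cauchyPDFReal_le_mul (x x₀ y : ℝ) :
    cauchyPDFReal x γ y ≤ 2 * (1 + ((x - x₀) / γ) ^ 2) * cauchyPDFReal x₀ γ y := by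
  have key : 1 + ((y - x₀) / γ) ^ 2 ≤
      2 * (1 + ((x - x₀) / γ) ^ 2) * (1 + ((y - x) / γ) ^ 2) := by
    have hsplit : (y - x₀) / γ = (x - x₀) / γ + (y - x) / γ := by ring
    rw [hsplit]
    nlinarith [sq_nonneg ((x - x₀) / γ - (y - x) / γ),
      mul_nonneg (sq_nonneg ((x - x₀) / γ)) (sq_nonneg ((y - x) / γ))]
  rw [cauchyPDFReal_def', cauchyPDFReal_def', mul_left_comm]
  refine mul_le_mul_of_nonneg_left ?_ (by positivity)
  rwa [← div_eq_mul_inv, le_div_iff₀ (by positivity), inv_mul_le_iff₀ (by positivity), mul_comm]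

theorem cauchyMeasure_le_smul_volume (hγ : γ ≠ 0) (x : ℝ) :
    cauchyMeasure x γ ≤ ENNReal.ofReal (π * γ)⁻¹ • volume := by
  rw [cauchyMeasure_of_scale_ne_zero x hγ, ← withDensity_const]
  exact withDensity_mono (ae_of_all _ fun y => ENNReal.ofReal_le_ofReal (cauchyPDFReal_le x y))

theorem cauchyMeasure_le_smul_cauchyMeasure (hγ : γ ≠ 0) (x x₀ : ℝ) :
    cauchyMeasure x γ ≤
      ENNReal.ofReal (2 * (1 + ((x - x₀) / γ) ^ 2)) • cauchyMeasure x₀ γ := by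
  rw [cauchyMeasure_of_scale_ne_zero x hγ, cauchyMeasure_of_scale_ne_zero x₀ hγ,
    ← withDensity_smul _ (measurable_cauchyPDF x₀ γ)]
  refine withDensity_mono (ae_of_all _ fun y => ?_)
  rw [Pi.smul_apply, smul_eq_mul, cauchyPDF_def, cauchyPDF_def,
    ← ENNReal.ofReal_mul (by positivity)]
  exact ENNReal.ofReal_le_ofReal (cauchyPDFReal_le_mul x x₀ y)

theorem integral_cauchyMeasure_le_inv_mul_integral (hγ : γ ≠ 0) {f : ℝ → ℝ} (hf : Integrable f)
    (hf0 : ∀ y, 0 ≤ f y) (x : ℝ) :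
    ∫ y, f y ∂cauchyMeasure x γ ≤ (π * γ)⁻¹ * ∫ y, f y := by
  refine (integral_mono_measure (cauchyMeasure_le_smul_volume hγ x) (ae_of_all _ hf0)
    (hf.smul_measure ENNReal.ofReal_ne_top)).trans_eq ?_
  rw [integral_smul_measure, ENNReal.toReal_ofReal (by positivity), smul_eq_mul]

theorem integral_cauchyMeasure_le_mul_integral_cauchyMeasure (hγ : γ ≠ 0) {f : ℝ → ℝ} {x₀ : ℝ}
    (hf : Integrable f (cauchyMeasure x₀ γ)) (hf0 : ∀ y, 0 ≤ f y) (x : ℝ) :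
    ∫ y, f y ∂cauchyMeasure x γ ≤
      2 * (1 + ((x - x₀) / γ) ^ 2) * ∫ y, f y ∂cauchyMeasure x₀ γ := by
  refine (integral_mono_measure (cauchyMeasure_le_smul_cauchyMeasure hγ x x₀) (ae_of_all _ hf0)
    (hf.smul_measure ENNReal.ofReal_ne_top)).trans_eq ?_
  rw [integral_smul_measure, ENNReal.toReal_ofReal (by positivity), smul_eq_mul]

theorem integrable_cauchyMeasure_of_integrable_cauchyMeasure (hγ : γ ≠ 0) {f : ℝ → ℝ} {x₀ : ℝ}
    (hf : Integrable f (cauchyMeasure x₀ γ)) (x : ℝ) : Integrable f (cauchyMeasure x γ) :=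
  (hf.smul_measure ENNReal.ofReal_ne_top).mono_measure (cauchyMeasure_le_smul_cauchyMeasure hγ x x₀)

theorem half_le_measureReal_cauchyMeasure (hγ : γ ≠ 0) (x : ℝ) :
    1 / 2 ≤ (cauchyMeasure x γ).real (Ioo (-(γ / 2 : ℝ)) (γ / 2))ᶜ := by
  have hIoo : (cauchyMeasure x γ).real (Ioo (-(γ / 2 : ℝ)) (γ / 2)) ≤ 1 / π := by
    refine ENNReal.toReal_le_of_le_ofReal (by positivity)
      ((cauchyMeasure_le_smul_volume hγ x _).trans_eq ?_)
    rw [Measure.smul_apply, Real.volume_Ioo, smul_eq_mul, ← ENNReal.ofReal_mul (by positivity)]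
    congr 1
    field_simp
    ring
  have hpi : 1 / π ≤ 1 / 2 := one_div_le_one_div_of_le two_pos Real.two_le_pi
  rw [probReal_compl_eq_one_sub measurableSet_Ioo]
  linarith

-- Only the tail `max (f - n) 0` feels the quadratic loss in comparing `x` with `0`, and for large
-- `n` the integral of the tail at `0` is as small as desired.
theorem exists_forall_integral_cauchyMeasure_le_add_mul_sq (hγ : γ ≠ 0) {f : ℝ → ℝ}
    (hf : Integrable f (cauchyMeasure 0 γ)) {δ : ℝ} (hδ : 0 < δ) :
    ∃ N, ∀ x, ∫ y, f y ∂cauchyMeasure x γ ≤ N + δ * x ^ 2 := by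
  have hγ' : (γ : ℝ) ≠ 0 := by exact_mod_cast hγ
  set η : ℝ := δ * γ ^ 2 / 2
  obtain ⟨n, hn⟩ : ∃ n : ℝ, ∫ y, max (f y - n) 0 ∂cauchyMeasure 0 γ ≤ η :=
    ((tendsto_integral_max_sub_zero hf).eventually (ge_mem_nhds (by positivity))).exists
  refine ⟨n + 2 * η, fun x => ?_⟩
  have htail : Integrable (fun y => max (f y - n) 0) (cauchyMeasure 0 γ) :=
    (hf.sub (integrable_const n)).sup (integrable_const 0)
  have htailx : Integrable (fun y => max (f y - n) 0) (cauchyMeasure x γ) :=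
    integrable_cauchyMeasure_of_integrable_cauchyMeasure hγ htail x
  calc ∫ y, f y ∂cauchyMeasure x γ
      ≤ ∫ y, (n + max (f y - n) 0) ∂cauchyMeasure x γ :=
        integral_mono (integrable_cauchyMeasure_of_integrable_cauchyMeasure hγ hf x)
          ((integrable_const n).add htailx) fun y => by linarith [le_max_left (f y - n) 0]
    _ = n + ∫ y, max (f y - n) 0 ∂cauchyMeasure x γ := by
        rw [integral_add (integrable_const n) htailx]
        simp
    _ ≤ n + 2 * (1 + ((x - 0) / γ) ^ 2) * η := by
        gcongr
        exact (integral_cauchyMeasure_le_mul_integral_cauchyMeasure hγ htail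
          (fun y => le_max_right _ _) x).trans (by gcongr)
    _ = n + 2 * η + δ * x ^ 2 := by
        simp only [η]
        field_simp
        ring

theorem measurable_cauchyMeasure (hγ : γ ≠ 0) : Measurable fun x => cauchyMeasure x γ := by
  have hpdf : Measurable (Function.uncurry fun x y => cauchyPDF x γ y) := by
    unfold cauchyPDF cauchyPDFReal
    fun_prop
  convert (Kernel.withDensity (Kernel.const ℝ volume) fun x y => cauchyPDF x γ y).measurable
    using 2 with x
  rw [Kernel.withDensity_apply _ hpdf, Kernel.const_apply, cauchyMeasure_of_scale_ne_zero x hγ]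

theorem integrable_cauchyMeasure_iff (hγ : γ ≠ 0) {f : ℝ → ℝ} {x : ℝ} :
    Integrable f (cauchyMeasure x γ) ↔ Integrable fun y => cauchyPDFReal x γ y * f y := by
  rw [cauchyMeasure_of_scale_ne_zero x hγ, integrable_withDensity_iff_integrable_smul'
    (measurable_cauchyPDF x γ) (ae_of_all _ fun y => ENNReal.ofReal_lt_top)]
  simp only [cauchyPDF_def, ENNReal.toReal_ofReal (cauchyPDF_pos x hγ _).le, smul_eq_mul]

theorem integral_cauchyMeasure (hγ : γ ≠ 0) (f : ℝ → ℝ) (x : ℝ) :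
    ∫ y, f y ∂cauchyMeasure x γ = ∫ y, cauchyPDFReal x γ y * f y := by
  rw [cauchyMeasure_of_scale_ne_zero x hγ, integral_withDensity_eq_integral_toReal_smul
    (measurable_cauchyPDF x γ) (ae_of_all _ fun y => ENNReal.ofReal_lt_top)]
  simp only [cauchyPDF_def, ENNReal.toReal_ofReal (cauchyPDF_pos x hγ _).le, smul_eq_mul]

end Cauchy

/-- `ε` solves the Yang-Yang equation with an arbitrary bare energy `e₀` in place of
`x² / (2 m) - h`. The kernel is normalized to the Cauchy distribution of scale `γ` centred at `x`,
so `γ` stands for `2 m g`. -/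
structure IsDressedEnergy (T : ℝ) (γ : ℝ≥0) (e₀ ε : ℝ → ℝ) : Prop where
  integrable : ∀ x, Integrable (fun y => softplus T (-ε y)) (cauchyMeasure x γ)
  equation : ∀ x, ε x = e₀ x - ∫ y, softplus T (-ε y) ∂cauchyMeasure x γ

theorem yangYangKernel_eq_mul_cauchyPDFReal {m g : ℝ} {γ : ℝ≥0} (hmg : 2 * m * g = γ) (x y : ℝ) :
    yangYangKernel m g x y = 2 * π * cauchyPDFReal x γ y := by
  have hpi := Real.pi_ne_zero
  rw [yangYangKernel, cauchyPDFReal_def, hmg, show 4 * m * g = 2 * γ by linarith,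
    ← neg_sq (x - y), neg_sub]
  field_simp

theorem isYangYangSolution_iff_isDressedEnergy {m g T h : ℝ} {γ : ℝ≥0} (hT : T ≠ 0) (hγ : γ ≠ 0)
    (hmg : 2 * m * g = γ) {ε : ℝ → ℝ} :
    IsYangYangSolution m g T h ε ↔ IsDressedEnergy T γ (fun x => x ^ 2 / (2 * m) - h) ε := by
  have hintegrand (x y : ℝ) :
      yangYangKernel m g x y * Real.log (1 + Real.exp (-(ε y / T))) =
        2 * π / T * (cauchyPDFReal x γ y * softplus T (-ε y)) := by
    rw [yangYangKernel_eq_mul_cauchyPDFReal hmg, softplus, neg_div]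
    field_simp
  have hcoeff : 2 * π / T ≠ 0 := div_ne_zero Real.two_pi_pos.ne' hT
  have hcancel (I : ℝ) : T / (2 * π) * (2 * π / T * I) = I := by
    field_simp
  have hintegrable (x : ℝ) :
      Integrable (fun y => yangYangKernel m g x y * Real.log (1 + Real.exp (-(ε y / T)))) ↔
        Integrable (fun y => softplus T (-ε y)) (cauchyMeasure x γ) := by
    simp only [hintegrand, integrable_cauchyMeasure_iff hγ]
    exact integrable_const_mul_iff hcoeff.isUnit _
  have hintegral (x : ℝ) :
      T / (2 * π) * ∫ y, yangYangKernel m g x y * Real.log (1 + Real.exp (-(ε y / T))) =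
        ∫ y, softplus T (-ε y) ∂cauchyMeasure x γ := by
    simp only [hintegrand, integral_cauchyMeasure hγ, integral_const_mul, hcancel]
  exact ⟨fun H => ⟨fun x => (hintegrable x).1 (H.integrable x),
      fun x => (H.equation x).trans (by rw [hintegral])⟩,
    fun H => ⟨fun x => (hintegrable x).2 (H.integrable x),
      fun x => (H.equation x).trans (by rw [hintegral])⟩⟩

section ConfiningEnergy

variable {T a b : ℝ} {γ : ℝ≥0} {e₀ ε : ℝ → ℝ}

theorem integral_softplus_sub_mul_sq_cauchyMeasure_le {E : ℝ} (hT : 0 < T) (hγ : γ ≠ 0)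
    (ha : 0 ≤ a) (hE : 0 ≤ E) (x : ℝ) :
    ∫ y, softplus T (E - a * y ^ 2) ∂cauchyMeasure x γ ≤
      E + T * Real.log 2 - min E (a * (γ / 2) ^ 2) / 2 := by
  have hlarge : ∀ y ∈ (Ioo (-(γ / 2 : ℝ)) (γ / 2))ᶜ, a * (γ / 2 : ℝ) ^ 2 ≤ a * y ^ 2 := by
    intro y hy
    have habs : (γ / 2 : ℝ) ≤ |y| := not_lt.1 fun hlt => hy (abs_lt.1 hlt)
    rw [← sq_abs y]
    gcongr
  have hmin : 0 ≤ min E (a * (γ / 2 : ℝ) ^ 2) := le_min hE (by positivity)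
  have hle := integral_softplus_sub_le (μ := cauchyMeasure x γ) hT hE
    (V := fun y => a * y ^ 2) (by fun_prop) (fun y => by positivity) measurableSet_Ioo.compl hlarge
  linarith [mul_le_mul_of_nonneg_left (half_le_measureReal_cauchyMeasure hγ x) hmin]

namespace IsDressedEnergy

theorem le_bare (H : IsDressedEnergy T γ e₀ ε) (hT : 0 ≤ T) (x : ℝ) : ε x ≤ e₀ x := by
  rw [H.equation x]
  exact sub_le_self _ (integral_nonneg fun y => softplus_nonneg hT _)

theorem bddAbove_sub (H : IsDressedEnergy T γ e₀ ε) (hT : 0 ≤ T) (hγ : γ ≠ 0) (ha : 0 < a)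
    (he₀ : ∀ y, a * y ^ 2 - b ≤ e₀ y) : BddAbove (range fun x => e₀ x - ε x) := by
  obtain ⟨N, hN⟩ := exists_forall_integral_cauchyMeasure_le_add_mul_sq hγ (H.integrable 0) ha
  have hneg (y : ℝ) : -ε y ≤ N + b := by linarith [hN y, H.equation y, he₀ y]
  refine ⟨softplus T (N + b), forall_mem_range.2 fun x => ?_⟩
  calc e₀ x - ε x = ∫ y, softplus T (-ε y) ∂cauchyMeasure x γ := by linarith [H.equation x]
    _ ≤ ∫ _, softplus T (N + b) ∂cauchyMeasure x γ :=
        integral_mono (H.integrable x) (integrable_const _) fun y =>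
          monotone_softplus hT (hneg y)
    _ = softplus T (N + b) := by simp

theorem sub_le_integral {M : ℝ} (H : IsDressedEnergy T γ e₀ ε) (hT : 0 ≤ T) (ha : 0 ≤ a)
    (he₀ : ∀ y, a * y ^ 2 - b ≤ e₀ y) (hM : ∀ y, e₀ y - ε y ≤ M) (x : ℝ) :
    e₀ x - ε x ≤ ∫ y, softplus T (M + b - a * y ^ 2) ∂cauchyMeasure x γ := by
  calc e₀ x - ε x = ∫ y, softplus T (-ε y) ∂cauchyMeasure x γ := by linarith [H.equation x]
    _ ≤ ∫ y, softplus T (M + b - a * y ^ 2) ∂cauchyMeasure x γ :=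
        integral_mono (H.integrable x)
          (integrable_softplus_of_le hT (by fun_prop) fun y => sub_le_self _ (by positivity))
          fun y => monotone_softplus hT (by linarith [hM y, he₀ y])

theorem sub_le (H : IsDressedEnergy T γ e₀ ε) (hT : 0 < T) (hγ : γ ≠ 0) (ha : 0 < a) (hb : 0 ≤ b)
    (he₀ : ∀ y, a * y ^ 2 - b ≤ e₀ y) (hlt : 2 * (b + T * Real.log 2) < a * (γ / 2) ^ 2)
    (x : ℝ) : e₀ x - ε x ≤ b + 2 * T * Real.log 2 := by
  set M := ⨆ y, (e₀ y - ε y)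
  have hM : ∀ y, e₀ y - ε y ≤ M := le_ciSup (H.bddAbove_sub hT.le hγ ha he₀)
  have hM0 : 0 ≤ M := (sub_nonneg.2 (H.le_bare hT.le 0)).trans (hM 0)
  have hsup : M ≤ M + b + T * Real.log 2 - min (M + b) (a * (γ / 2) ^ 2) / 2 :=
    ciSup_le fun y => (H.sub_le_integral hT.le ha.le he₀ hM y).trans
      (integral_softplus_sub_mul_sq_cauchyMeasure_le hT hγ ha.le (by positivity) y)
  have hmin : min (M + b) (a * (γ / 2) ^ 2) ≤ 2 * (b + T * Real.log 2) := by linarith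
  have hMb := (min_le_iff.1 hmin).resolve_right hlt.not_ge
  linarith [hM x]

theorem abs_sub_le (H : IsDressedEnergy T γ e₀ ε) (hT : 0 < T) (hγ : γ ≠ 0) (ha : 0 < a)
    (hb : 0 ≤ b) (he₀ : ∀ y, a * y ^ 2 - b ≤ e₀ y)
    (hlt : 2 * (b + T * Real.log 2) < a * (γ / 2) ^ 2) (x : ℝ) :
    |ε x - e₀ x| ≤
      (π * γ)⁻¹ * (T * Real.exp (2 * (b + T * Real.log 2) / T) * √(π * T / a)) := by
  rw [abs_sub_comm, abs_of_nonneg (sub_nonneg.2 (H.le_bare hT.le x))]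
  calc e₀ x - ε x
      ≤ ∫ y, softplus T (b + 2 * T * Real.log 2 + b - a * y ^ 2) ∂cauchyMeasure x γ :=
        H.sub_le_integral hT.le ha.le he₀ (H.sub_le hT hγ ha hb he₀ hlt) x
    _ ≤ (π * γ)⁻¹ * ∫ y, softplus T (b + 2 * T * Real.log 2 + b - a * y ^ 2) :=
        integral_cauchyMeasure_le_inv_mul_integral hγ (integrable_softplus_sub_mul_sq hT ha _)
          (fun y => softplus_nonneg hT.le _) x
    _ ≤ _ := by
        rw [show b + 2 * T * Real.log 2 + b = 2 * (b + T * Real.log 2) by ring]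
        gcongr
        exact integral_softplus_sub_mul_sq_le hT ha _

end IsDressedEnergy

theorem integral_softplus_sub_le_of_mul_sq_sub_le (hT : 0 < T) (hγ : γ ≠ 0) (ha : 0 ≤ a)
    (hb : 0 ≤ b) (hmeas : Measurable e₀) (he₀ : ∀ y, a * y ^ 2 - b ≤ e₀ y)
    (hle : 2 * (b + T * Real.log 2) ≤ a * (γ / 2) ^ 2) (x : ℝ) :
    ∫ y, softplus T (b + 2 * T * Real.log 2 - e₀ y) ∂cauchyMeasure x γ ≤
      b + 2 * T * Real.log 2 := by
  set E := 2 * (b + T * Real.log 2)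
  have hpt (y : ℝ) : b + 2 * T * Real.log 2 - e₀ y ≤ E - a * y ^ 2 := by linarith [he₀ y]
  have hE (y : ℝ) : E - a * y ^ 2 ≤ E := sub_le_self _ (by positivity)
  calc ∫ y, softplus T (b + 2 * T * Real.log 2 - e₀ y) ∂cauchyMeasure x γ
      ≤ ∫ y, softplus T (E - a * y ^ 2) ∂cauchyMeasure x γ :=
        integral_mono
          (integrable_softplus_of_le hT.le (by fun_prop) fun y => (hpt y).trans (hE y))
          (integrable_softplus_of_le hT.le (by fun_prop) hE)
          fun y => monotone_softplus hT.le (hpt y)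
    _ ≤ E + T * Real.log 2 - min E (a * (γ / 2) ^ 2) / 2 :=
        integral_softplus_sub_mul_sq_cauchyMeasure_le hT hγ ha (by positivity) x
    _ = b + 2 * T * Real.log 2 := by
        rw [min_eq_left hle]
        ring

theorem exists_isDressedEnergy (hT : 0 < T) (hγ : γ ≠ 0) (ha : 0 ≤ a) (hb : 0 ≤ b)
    (hmeas : Measurable e₀) (he₀ : ∀ y, a * y ^ 2 - b ≤ e₀ y)
    (hle : 2 * (b + T * Real.log 2) ≤ a * (γ / 2) ^ 2) :
    ∃ ε, IsDressedEnergy T γ e₀ ε := by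
  set M := b + 2 * T * Real.log 2
  have hM : 0 ≤ M := by positivity
  have hint {D : ℝ → ℝ} (hD : Measurable D) (hDM : ∀ y, D y ≤ M) (x : ℝ) :
      Integrable (fun y => softplus T (D y - e₀ y)) (cauchyMeasure x γ) :=
    integrable_softplus_of_le hT.le (hD.sub hmeas) (M := M + b) fun y => by
      linarith [hDM y, he₀ y, show 0 ≤ a * y ^ 2 by positivity]
  obtain ⟨D, hD, ⟨-, hDM⟩, hfix⟩ := exists_eq_hammerstein_of_le_of_ge
    (κ := ⟨fun x => cauchyMeasure x γ, measurable_cauchyMeasure hγ⟩)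
    (φ := fun y d => softplus T (d - e₀ y)) (a := 0) (b := fun _ => M)
    ((continuous_softplus T).measurable.comp (measurable_snd.sub (hmeas.comp measurable_fst)))
    (fun y d d' hd => monotone_softplus hT.le (sub_le_sub_right hd _))
    (fun y => (continuous_softplus T).comp (by fun_prop)) measurable_zero
    (fun _ => hM) (hint measurable_zero fun _ => hM) (hint measurable_const fun _ => le_rfl)
    (fun x => integral_nonneg fun y => softplus_nonneg hT.le _)
    (integral_softplus_sub_le_of_mul_sq_sub_le hT hγ ha hb hmeas he₀ hle)
  refine ⟨fun x => e₀ x - D x, fun x => ?_, fun x => ?_⟩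
  · simpa only [neg_sub] using hint hD hDM x
  · simp only [neg_sub]
    exact congrArg (e₀ x - ·) (congrFun hfix x)

end ConfiningEnergy

theorem mainTheorem8_general (T h c : ℝ) (hT : 0 < T) (hc : 0 < c) :
    ∃ C m₀ : ℝ, 0 < C ∧ 0 < m₀ ∧
      ∀ m g : ℝ, 0 < m → m < m₀ → 2 * m * g = c →
        (∃ ε : ℝ → ℝ, IsYangYangSolution m g T h ε) ∧
        ∀ ε : ℝ → ℝ, IsYangYangSolution m g T h ε →
          ∀ x : ℝ, |ε x - (x ^ 2 / (2 * m) - h)| ≤ C * Real.sqrt m := by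
  lift c to ℝ≥0 using hc.le
  have hc' : c ≠ 0 := by exact_mod_cast hc.ne'
  set B := 2 * (|h| + T * Real.log 2)
  have hB : 0 < 8 * B := by positivity
  refine ⟨(π * c)⁻¹ * (T * Real.exp (B / T) * √(2 * π * T)), c ^ 2 / (8 * B), by positivity,
    div_pos (by positivity) hB, fun m g hm hm₀ hmg => ?_⟩
  simp only [isYangYangSolution_iff_isDressedEnergy hT.ne' hc' hmg]
  have hbare (y : ℝ) : 1 / (2 * m) * y ^ 2 - |h| ≤ y ^ 2 / (2 * m) - h := by
    rw [one_div_mul_eq_div]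
    linarith [le_abs_self h]
  have hBm : B < 1 / (2 * m) * (c / 2) ^ 2 := by
    rw [lt_div_iff₀ hB] at hm₀
    rw [one_div_mul_eq_div, lt_div_iff₀ (by positivity)]
    linarith
  refine ⟨exists_isDressedEnergy hT hc' (by positivity) (abs_nonneg h) (by fun_prop) hbare hBm.le,
    fun ε hε x => (hε.abs_sub_le hT hc' (by positivity) (abs_nonneg h) hbare hBm x).trans_eq ?_⟩
  rw [show π * T / (1 / (2 * m)) = 2 * π * T * m by field_simp, Real.sqrt_mul (by positivity)]
  ring

theorem mainTheorem8 (T h c : ℝ) (hT : 0 < T) (hh : 0 < h) (hc : 0 < c) :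
    ∃ C m₀ : ℝ, 0 < C ∧ 0 < m₀ ∧
      ∀ m g : ℝ, 0 < m → m < m₀ → 0 < g → 2 * m * g = c →
        (∃ ε : ℝ → ℝ, IsYangYangSolution m g T h ε) ∧
        ∀ ε : ℝ → ℝ, IsYangYangSolution m g T h ε →
          ∀ x : ℝ, |ε x - (x ^ 2 / (2 * m) - h)| ≤ C * Real.sqrt m := by
  obtain ⟨C, m₀, hC, hm₀, H⟩ := mainTheorem8_general T h c hT hc
  exact ⟨C, m₀, hC, hm₀, fun m g hm hlt _ => H m g hm hlt⟩
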